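/- All graphs are finite and simple. A connected graph with $n$ vertices and $n+c-1$ edges is called $c$-cyclic. A $c$-cyclic degree sequence is a sequence $\pi=(d_1\ge d_2\ge\dots\ge d_n)$ such that some $c$-cyclic graph on vertices $v_1,\dots,v_n$ satisfies $d(v_i)=d_i$ for all $i$; $\Gamma(\pi)$ is the set of all connected graphs on $v_1,\dots,v_n$ with $d(v_i)=d_i$ for all $i$. A symmetric function $f(x,y)$ of two positive real variables is escalating (resp. de-escalating) if $$f(x_1,x_2)+f(y_1,y_2)\ \ge\ (\text{resp. }\le)\ \ f(x_2,y_1)+f(x_1,y_2)\qquad\text{for all } x_1\ge y_1>0,\ x_2\ge y_2>0,$$ with strict inequality whenever $x_1>y_1$ and $x_2>y_2$. Put $M_f(G)=\sum_{uv\in E(G)}f(d(u),d(v))$. A connected graph $G$ is a BFS-graph with respect to the ordering $v_1\prec v_2\prec\dots\prec v_n$ of its vertices if, writing $h(v)$ for the distance from $v_1$ to $v$: (i) $d(v_1)\ge\dots\ge d(v_n)$ and $h(v_1)\le\dots\le h(v_n)$; (ii) whenever $v\in N(u)\setminus N(w)$, $z\in N(w)\setminus N(u)$, $h(u)=h(w)=h(v)-1=h(z)-1$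 and $u\prec w$, then $v\prec z$. Theorem. Let $c\ge 0$ and let $\pi=(d_1,\dots,d_n)$ be a $c$-cyclic degree sequence with $d_n=1$. If $f$ is escalating (resp. de-escalating), then there is a graph $G\in\Gamma(\pi)$ that maximizes (resp. minimizes) $M_f$ over $\Gamma(\pi)$, that is a BFS-graph with respect to the ordering $v_1\prec v_2\prec\dots\prec v_n$, and in which, if $c\ge1$, the vertices $v_1,v_2,v_3$ form a triangle. -/

import Mathlib

/-- `f` is a symmetric function of two positive real variables
(its values elsewhere play no role). -/
def SymmetricOnPos (f : ℝ → ℝ → ℝ) : Prop :=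
  ∀ x y : ℝ, 0 < x → 0 < y → f x y = f y x

/-- Escalating functions of two positive real variables. -/
structure IsEscalating (f : ℝ → ℝ → ℝ) : Prop where
  symm : SymmetricOnPos f
  le : ∀ x₁ y₁ x₂ y₂ : ℝ, 0 < y₁ → y₁ ≤ x₁ → 0 < y₂ → y₂ ≤ x₂ →
    f x₂ y₁ + f x₁ y₂ ≤ f x₁ x₂ + f y₁ y₂
  lt : ∀ x₁ y₁ x₂ y₂ : ℝ, 0 < y₁ → y₁ < x₁ → 0 < y₂ → y₂ < x₂ →
    f x₂ y₁ + f x₁ y₂ < f x₁ x₂ + f y₁ y₂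

/-- De-escalating functions of two positive real variables. -/
structure IsDeEscalating (f : ℝ → ℝ → ℝ) : Prop where
  symm : SymmetricOnPos f
  le : ∀ x₁ y₁ x₂ y₂ : ℝ, 0 < y₁ → y₁ ≤ x₁ → 0 < y₂ → y₂ ≤ x₂ →
    f x₁ x₂ + f y₁ y₂ ≤ f x₂ y₁ + f x₁ y₂
  lt : ∀ x₁ y₁ x₂ y₂ : ℝ, 0 < y₁ → y₁ < x₁ → 0 < y₂ → y₂ < x₂ →
    f x₁ x₂ + f y₁ y₂ < f x₂ y₁ + f x₁ y₂

open Classical in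
/-- The connectivity function `M_f(G)`: the sum over the edges `uv` of `G` of `f (d u) (d v)`.
To have a function of the unordered pair `uv` for every `f`, the summand is written as the mean of
`f (d u) (d v)` and `f (d v) (d u)`; for symmetric `f` these two numbers agree
(see `connectivity_eq_sum`). -/
noncomputable def connectivity {V : Type*} [Fintype V] (f : ℝ → ℝ → ℝ) (G : SimpleGraph V) : ℝ :=
  ∑ e ∈ G.edgeFinset,
    Sym2.lift ⟨fun u v => (f (G.degree u) (G.degree v) + f (G.degree v) (G.degree u)) / 2,
      fun _ _ => congrArg (fun t : ℝ => t / 2) (add_comm _ _)⟩ e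

open Classical in
/-- Sanity check: for a function that is symmetric on positive arguments, `connectivity` is the sum
of `f (d u) (d v)` over the edges `uv`, whatever orientation is used to read off `u` and `v`. -/
theorem connectivity_eq_sum {V : Type*} [Fintype V] (f : ℝ → ℝ → ℝ) (hf : SymmetricOnPos f)
    (G : SimpleGraph V) (a b : Sym2 V → V) (hab : ∀ e, s(a e, b e) = e) :
    connectivity f G = ∑ e ∈ G.edgeFinset, f (G.degree (a e)) (G.degree (b e)) := by
  unfold connectivity
  refine Finset.sum_congr rfl fun e he => ?_
  have hadj : G.Adj (a e) (b e) := by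
    have h1 : s(a e, b e) ∈ G.edgeSet := by
      rw [hab e]; exact SimpleGraph.mem_edgeFinset.1 he
    exact h1
  have ha : (0 : ℝ) < G.degree (a e) :=
    Nat.cast_pos.2 ((G.degree_pos_iff_exists_adj _).2 ⟨_, hadj⟩)
  have hb : (0 : ℝ) < G.degree (b e) :=
    Nat.cast_pos.2 ((G.degree_pos_iff_exists_adj _).2 ⟨_, hadj.symm⟩)
  conv_lhs => rw [← hab e]
  rw [Sym2.lift_mk]
  simp only [hf _ _ hb ha]
  ring

open Classical in
/-- A `c`-cyclic graph: a connected simple graph with `m = n + c - 1` edges on `n` vertices. -/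
def IsCyclicGraph {V : Type*} [Fintype V] (c : ℕ) (G : SimpleGraph V) : Prop :=
  G.Connected ∧ G.edgeFinset.card + 1 = Fintype.card V + c

open Classical in
/-- `Γ(π)`: the connected simple graphs with degree sequence `π = (d₁, …, dₙ)`. The vertices
`v₁, …, vₙ` are the elements of `Fin n` in their order, and `vᵢ` has degree `dᵢ`. -/
def GraphsWithDegrees {n : ℕ} (d : Fin n → ℕ) : Set (SimpleGraph (Fin n)) :=
  {G | G.Connected ∧ ∀ i, G.degree i = d i}

/-- `π = (d₁ ≥ d₂ ≥ … ≥ dₙ)` is the degree sequence of some `c`-cyclic graph. -/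
def IsCyclicDegreeSequence {n : ℕ} (c : ℕ) (d : Fin n → ℕ) : Prop :=
  Antitone d ∧ ∃ G ∈ GraphsWithDegrees d, IsCyclicGraph c G

open Classical in
/-- The ordering `σ 0 ≺ σ 1 ≺ … ≺ σ (n-1)` of the vertices makes the connected graph `G` a
BFS-graph, where `h v` is the distance from the first vertex `σ 0` to `v`. -/
structure IsBFSOrdering {V : Type*} [Fintype V] {n : ℕ} [NeZero n]
    (G : SimpleGraph V) (σ : Fin n ≃ V) : Prop where
  connected : G.Connected
  degree_anti : ∀ i j : Fin n, i ≤ j → G.degree (σ j) ≤ G.degree (σ i)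
  dist_mono : ∀ i j : Fin n, i ≤ j → G.dist (σ 0) (σ i) ≤ G.dist (σ 0) (σ j)
  children : ∀ u w v z : Fin n,
    G.Adj (σ u) (σ v) → ¬ G.Adj (σ w) (σ v) →
    G.Adj (σ w) (σ z) → ¬ G.Adj (σ u) (σ z) →
    G.dist (σ 0) (σ u) = G.dist (σ 0) (σ w) →
    G.dist (σ 0) (σ v) = G.dist (σ 0) (σ u) + 1 →
    G.dist (σ 0) (σ z) = G.dist (σ 0) (σ u) + 1 →
    u < w → v < z

/-- `v₁, v₂, v₃` exist and form a triangle of `G`. -/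
def FirstThreeFormTriangle {n : ℕ} (G : SimpleGraph (Fin n)) : Prop :=
  ∃ h : 3 ≤ n,
    G.Adj ⟨0, by omega⟩ ⟨1, by omega⟩ ∧
    G.Adj ⟨0, by omega⟩ ⟨2, by omega⟩ ∧
    G.Adj ⟨1, by omega⟩ ⟨2, by omega⟩

/-!
Among the maximizers of `M_f` choose one that maximizes the sum over the edges `ab` of the product
of the positions of `a` and `b`. Replacing edges `uv`, `xy` by `uy`, `xv`, where `u ≺ x` and
`y ≺ v`, does not decrease `M_f` and increases that sum, so it must disconnect the graph. If
`u ≺ w`, then `d(u) ≥ d(w)`, hence any neighbour of `w` outside `N(u) ∪ {u}` can be switched with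
some neighbour of `u` outside `N(w) ∪ {w}` without disconnecting the graph, which locates the latter
before the former. This yields the BFS ordering.

If `c ≥ 1`, some vertex has two neighbours before it; let `a' ≺ a` be such neighbours of `b` with
`a` as early as possible. The vertices before `a` induce a tree, with each `x ≠ v₁` having a unique
parent before it, and optimality gives every vertex before `a`, except `a'` and the neighbours of
`a`, a child before `a`. As `v₂`, `v₃`, `v₄` are all children of `v₁`, counting parents yields
`a ≼ v₄`, and the three remaining positions of `a` are settled directly.
-/

open SimpleGraph

section Reachability

variable {V : Type*} {G H : SimpleGraph V}

theorem connected_of_forall_adj_reachable (hG : G.Connected)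
    (h : ∀ a b, G.Adj a b → H.Reachable a b) : H.Connected := by
  have := hG.nonempty
  refine ⟨fun a b => ?_⟩
  obtain ⟨p⟩ := hG.preconnected a b
  induction p with
  | nil => exact .rfl
  | cons hab _ ih => exact (h _ _ hab).trans ih

theorem exists_adj_reachable_deleteIncidenceSet {a b : V} (hab : a ≠ b) (h : G.Reachable a b) :
    ∃ s, G.Adj a s ∧ (G.deleteIncidenceSet a).Reachable s b := by
  classical
  obtain ⟨p, hp⟩ := h.exists_isPath
  cases p with
  | nil => exact absurd rfl hab
  | @cons _ s _ has q =>
    have haq : a ∉ q.support := ((Walk.cons_isPath_iff has q).1 hp).2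
    exact ⟨s, has, ⟨q.toDeleteEdges _ fun e he hea => haq
      (q.mem_support_of_mem_edges he hea.2)⟩⟩

theorem reachable_deleteEdges_or_of_reachable {a b x : V} (h : G.Reachable a b) :
    (G.deleteEdges {s(x, b)}).Reachable a b ∨ (G.deleteEdges {s(x, b)}).Reachable a x := by
  obtain ⟨p⟩ := h
  induction p with
  | nil => exact .inl .rfl
  | @cons a c b hac _ ih =>
    by_cases he : s(a, c) = s(x, b)
    · rcases Sym2.eq_iff.1 he with ⟨rfl, -⟩ | ⟨rfl, -⟩
      · exact .inr .rfl
      · exact .inl .rfl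
    · have hac' : (G.deleteEdges {s(x, b)}).Reachable a c :=
        (deleteEdges_adj.2 ⟨hac, he⟩).reachable
      exact ih.imp hac'.trans hac'.trans

theorem reachable_bot_of_forall_exists_adj_lt [PartialOrder V] [OrderBot V] [WellFoundedLT V]
    {p x : V} (h : ∀ y < p, y ≠ ⊥ → ∃ z < y, G.Adj y z) (hx : x < p) : G.Reachable x ⊥ := by
  induction x using WellFoundedLT.induction with
  | _ x ih =>
    by_cases hx0 : x = ⊥
    · exact hx0 ▸ .rfl
    · obtain ⟨z, hzx, hxz⟩ := h x hx hx0
      exact hxz.reachable.trans (ih z hzx (hzx.trans hx))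

theorem exists_adj_dist_add_one_eq {r x : V} (h : G.Reachable r x) (hx : x ≠ r) :
    ∃ y, G.Adj x y ∧ G.dist r y + 1 = G.dist r x := by
  obtain ⟨p, hp⟩ := h.symm.exists_walk_length_eq_dist
  cases p with
  | nil => exact absurd rfl hx
  | @cons _ y _ hxy q =>
    refine ⟨y, hxy, ?_⟩
    have hle : G.dist r y ≤ q.length := dist_comm (G := G) ▸ dist_le q
    have hlen : q.length + 1 = G.dist r x := dist_comm (G := G) ▸ hp
    have := hxy.diff_dist_adj (u := r)
    omega

theorem dist_le_dist_add_one {r x y : V} (h : G.Adj x y) : G.dist r y ≤ G.dist r x + 1 := by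
  have := h.diff_dist_adj (u := r)
  omega

end Reachability

section Switch

variable {V : Type*} {G : SimpleGraph V} {u v w x y : V}

/-- The private neighbours of `u` with respect to `w`: those that are neither equal nor adjacent
to `w`. -/
def privateNeighbors (G : SimpleGraph V) (u w : V) : Set V :=
  {x | G.Adj u x ∧ x ≠ w ∧ ¬ G.Adj w x}

theorem finite_privateNeighbors [G.LocallyFinite] : (privateNeighbors G u w).Finite :=
  (G.neighborSet u).toFinite.subset fun _ hx => hx.1

theorem ncard_privateNeighbors_le [G.LocallyFinite] (h : G.degree w ≤ G.degree u) :
    (privateNeighbors G w u).ncard ≤ (privateNeighbors G u w).ncard := by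
  have hsdiff (a b : V) :
      privateNeighbors G a b = (G.neighborSet a \ {b}) \ (G.neighborSet b \ {a}) := by
    ext x
    have : G.Adj a x → x ≠ a := fun h => h.ne'
    simp only [privateNeighbors, Set.mem_ofPred_eq, Set.mem_sdiff, mem_neighborSet,
      Set.mem_singleton_iff]
    tauto
  have hncard (a : V) : (G.neighborSet a).ncard = G.degree a := by
    rw [← Nat.card_coe_set_eq, Nat.card_eq_fintype_card, card_neighborSet_eq_degree]
  rw [hsdiff, hsdiff, ← Set.ncard_le_ncard_iff_ncard_sdiff_le_ncard_sdiff
    ((G.neighborSet w).toFinite.sdiff) ((G.neighborSet u).toFinite.sdiff)]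
  by_cases hadj : G.Adj u w
  · rw [Set.ncard_sdiff_singleton_of_mem ((mem_neighborSet ..).2 hadj.symm),
      Set.ncard_sdiff_singleton_of_mem ((mem_neighborSet ..).2 hadj), hncard, hncard]
    omega
  · rwa [Set.sdiff_singleton_eq_self (mt (mem_neighborSet ..).1 (hadj ∘ Adj.symm)),
      Set.sdiff_singleton_eq_self (mt (mem_neighborSet ..).1 hadj), hncard, hncard]

/-- The graph obtained from `G` by replacing the edges `uv`, `xy` with `uy`, `xv`. It is simple and
has the degrees of `G` when `v` is a private neighbour of `u` with respect to `x` and `y` is one of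
`x` with respect to `u`. -/
def edgeSwitch (G : SimpleGraph V) (u v x y : V) : SimpleGraph V :=
  G.deleteEdges {s(u, v), s(x, y)} ⊔ edge u y ⊔ edge x v

theorem deleteEdges_le_edgeSwitch : G.deleteEdges {s(u, v), s(x, y)} ≤ edgeSwitch G u v x y :=
  le_sup_left.trans le_sup_left

theorem connected_edgeSwitch (hG : G.Connected)
    (hv : v ∈ privateNeighbors G u x) (hy : y ∈ privateNeighbors G x u)
    (h : (G.deleteEdges {s(u, v), s(x, y)}).Reachable u x ∨
      (G.deleteEdges {s(u, v), s(x, y)}).Reachable y v) : (edgeSwitch G u v x y).Connected := by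
  have huy : (edgeSwitch G u v x y).Reachable u y :=
    Adj.reachable (.inl (.inr ((edge_adj ..).2 ⟨.inl ⟨rfl, rfl⟩, hy.2.1.symm⟩)))
  have hxv : (edgeSwitch G u v x y).Reachable x v :=
    Adj.reachable (.inr ((edge_adj ..).2 ⟨.inl ⟨rfl, rfl⟩, hv.2.1.symm⟩))
  obtain ⟨huv, hxy⟩ : (edgeSwitch G u v x y).Reachable u v ∧
      (edgeSwitch G u v x y).Reachable x y := by
    rcases h with hux | hyv
    · have hux := hux.mono deleteEdges_le_edgeSwitch
      exact ⟨hux.trans hxv, hux.symm.trans huy⟩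
    · have hyv := hyv.mono deleteEdges_le_edgeSwitch
      exact ⟨huy.trans hyv, hxv.trans hyv.symm⟩
  refine connected_of_forall_adj_reachable hG fun a b hab => ?_
  by_cases hdel : s(a, b) ∈ ({s(u, v), s(x, y)} : Set (Sym2 V))
  · rcases hdel with hdel | hdel <;> rcases Sym2.eq_iff.1 hdel with ⟨rfl, rfl⟩ | ⟨rfl, rfl⟩
    exacts [huv, huv.symm, hxy, hxy.symm]
  · exact (deleteEdges_le_edgeSwitch (deleteEdges_adj.2 ⟨hab, hdel⟩)).reachable

open Classical in
theorem sum_edgeFinset_edgeSwitch [Fintype V] {M : Type*} [AddCommMonoid M] (g : Sym2 V → M)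
    (hux : u ≠ x) (hv : v ∈ privateNeighbors G u x) (hy : y ∈ privateNeighbors G x u) :
    ∑ e ∈ (edgeSwitch G u v x y).edgeFinset, g e + (g s(u, v) + g s(x, y)) =
      ∑ e ∈ G.edgeFinset, g e + (g s(u, y) + g s(x, v)) := by
  obtain ⟨huv, hvx, hxv⟩ := hv
  obtain ⟨hxy, hyu, huy⟩ := hy
  set D := G.deleteEdges {s(u, v), s(x, y)} with hD
  have hne : s(u, v) ≠ s(x, y) := by simp [hux, hyu.symm]
  have hdel : ∑ e ∈ D.edgeFinset, g e + (g s(u, v) + g s(x, y)) = ∑ e ∈ G.edgeFinset, g e := by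
    have hDsdiff : D.edgeFinset = G.edgeFinset \ {s(u, v), s(x, y)} := by
      ext e
      simp [hD]
    have hsub : {s(u, v), s(x, y)} ⊆ G.edgeFinset := by
      simp [Finset.insert_subset_iff, huv, hxy]
    rw [hDsdiff, ← Finset.sum_sdiff hsub, Finset.sum_pair hne]
  have hDuy : ¬ D.Adj u y := fun h => huy (deleteEdges_le _ h)
  have hadd : ∑ e ∈ (edgeSwitch G u v x y).edgeFinset, g e =
      g s(x, v) + (g s(u, y) + ∑ e ∈ D.edgeFinset, g e) := by
    have hswitch : (edgeSwitch G u v x y).edgeFinset =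
        insert s(x, v) (insert s(u, y) D.edgeFinset) := by
      refine Finset.ext (Sym2.ind fun a b => ?_)
      rw [mem_edgeFinset, mem_edgeSet]
      simp only [edgeSwitch, ← hD, mem_edgeFinset, mem_edgeSet, Finset.mem_insert, sup_adj,
        edge_adj, Sym2.eq_iff]
      grind
    have hxv' : s(x, v) ∉ insert s(u, y) D.edgeFinset := by
      simp [hD, hxv, hux.symm, huv.ne']
    rw [hswitch, Finset.sum_insert hxv', Finset.sum_insert (mt mem_edgeFinset.1 hDuy)]
  rw [hadd, ← hdel]
  abel

open Classical in
theorem degree_eq_sum_edgeFinset [Fintype V] (H : SimpleGraph V) (w : V) :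
    H.degree w = ∑ e ∈ H.edgeFinset, if w ∈ e then 1 else 0 := by
  rw [← card_incidenceFinset_eq_degree, incidenceFinset_eq_filter, Finset.card_filter]

open Classical in
theorem degree_edgeSwitch [Fintype V] (hux : u ≠ x) (hv : v ∈ privateNeighbors G u x)
    (hy : y ∈ privateNeighbors G x u) (w : V) :
    (edgeSwitch G u v x y).degree w = G.degree w := by
  have hsum := sum_edgeFinset_edgeSwitch (fun e => if w ∈ e then 1 else 0) hux hv hy
  have hends : ((if w ∈ s(u, v) then 1 else 0) + (if w ∈ s(x, y) then 1 else 0) : ℕ) =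
      (if w ∈ s(u, y) then 1 else 0) + (if w ∈ s(x, v) then 1 else 0) := by
    have := hv.1.ne
    have := hy.1.ne
    have := hv.2.1
    have := hy.2.1
    simp only [Sym2.mem_iff]
    grind
  rw [degree_eq_sum_edgeFinset, degree_eq_sum_edgeFinset]
  omega

theorem deleteEdges_deleteIncidenceSet_le :
    (G.deleteEdges {s(w, x)}).deleteIncidenceSet u ≤ G.deleteEdges {s(u, v), s(w, x)} := by
  intro a b hab
  simp only [deleteIncidenceSet_adj, deleteEdges_adj, Set.mem_singleton_iff,
    Set.mem_insert_iff, Sym2.eq_iff] at hab ⊢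
  tauto

theorem reachable_deleteEdges_of_adj_of_notMem_privateNeighbors {t : V} (huw : u ≠ w)
    (hwt : G.Adj w t) (ht : t ∉ privateNeighbors G w u) (hv : v ∈ privateNeighbors G u w)
    (hx : x ∈ privateNeighbors G w u) : (G.deleteEdges {s(u, v), s(w, x)}).Reachable u w := by
  have htx : t ≠ x := fun h => ht (h ▸ hx)
  have hvt : v ≠ t := fun h => hv.2.2 (h ▸ hwt)
  have hvw := hv.2.1
  have hxu := hx.2.1
  have hwt' : (G.deleteEdges {s(u, v), s(w, x)}).Adj w t :=
    deleteEdges_adj.2 ⟨hwt, by simp only [Set.mem_insert_iff, Set.mem_singleton_iff]; grind⟩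
  by_cases htu : t = u
  · exact (htu ▸ hwt').symm.reachable
  have hut : G.Adj u t := by
    by_contra h
    exact ht ⟨hwt, htu, h⟩
  have hut' : (G.deleteEdges {s(u, v), s(w, x)}).Adj u t :=
    deleteEdges_adj.2 ⟨hut, by simp only [Set.mem_insert_iff, Set.mem_singleton_iff]; grind⟩
  exact hut'.reachable.trans hwt'.symm.reachable

theorem exists_reachable_of_reachable_deleteEdges [G.LocallyFinite] (huw : u ≠ w)
    (hdeg : G.degree w ≤ G.degree u) (hx : x ∈ privateNeighbors G w u)
    (h : (G.deleteEdges {s(w, x)}).Reachable u w) :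
    ∃ v ∈ privateNeighbors G u w, (G.deleteEdges {s(u, v), s(w, x)}).Reachable u w := by
  have hncard := ncard_privateNeighbors_le hdeg
  obtain ⟨s, hus, hsw⟩ := exists_adj_reachable_deleteIncidenceSet huw h
  obtain ⟨t, hwt, -⟩ := exists_adj_reachable_deleteIncidenceSet huw.symm h.symm
  rw [deleteEdges_adj, Set.mem_singleton_iff] at hwt hus
  by_cases ht : t ∈ privateNeighbors G w u
  · have htx : t ≠ x := fun htx => hwt.2 (htx ▸ rfl)
    have hone : 1 < (privateNeighbors G u w).ncard :=
      lt_of_lt_of_le ((Set.one_lt_ncard finite_privateNeighbors).2 ⟨t, ht, x, hx, htx⟩) hncard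
    obtain ⟨v, hv, hvs⟩ := Set.exists_ne_of_one_lt_ncard hone s
    have hus' : (G.deleteEdges {s(u, v), s(w, x)}).Adj u s := by
      have := hx.2.1
      simp only [deleteEdges_adj, Set.mem_insert_iff, Set.mem_singleton_iff]
      grind
    exact ⟨v, hv, hus'.reachable.trans (hsw.mono deleteEdges_deleteIncidenceSet_le)⟩
  · obtain ⟨v, hv⟩ : (privateNeighbors G u w).Nonempty := by
      rw [← Set.ncard_pos finite_privateNeighbors]
      exact lt_of_lt_of_le ((Set.ncard_pos finite_privateNeighbors).2 ⟨x, hx⟩) hncard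
    exact ⟨v, hv,
      reachable_deleteEdges_of_adj_of_notMem_privateNeighbors huw hwt.1 ht hv hx⟩

theorem exists_reachable_of_degree_le [G.LocallyFinite] (hG : G.Connected) (huw : u ≠ w)
    (hdeg : G.degree w ≤ G.degree u) (hx : x ∈ privateNeighbors G w u) :
    ∃ v ∈ privateNeighbors G u w, (G.deleteEdges {s(u, v), s(w, x)}).Reachable u w ∨
      (G.deleteEdges {s(u, v), s(w, x)}).Reachable x v := by
  by_cases h : (G.deleteEdges {s(w, x)}).Reachable u w
  · obtain ⟨v, hv, huw⟩ := exists_reachable_of_reachable_deleteEdges huw hdeg hx h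
    exact ⟨v, hv, .inl huw⟩
  -- The edge `wx` is a bridge with `x` on the side of `u`; take `v` next on a path `u, …, x`.
  obtain ⟨s, hus, hsx⟩ := exists_adj_reachable_deleteIncidenceSet hx.2.1.symm
    (hG.preconnected u x)
  have hsx_ne : s ≠ x := fun h => hx.2.2 (h ▸ hus)
  have hxu := hx.2.1
  have hus' : (G.deleteEdges {s(w, x)}).Reachable u s :=
    (deleteEdges_adj.2 ⟨hus, by rw [Set.mem_singleton_iff]; grind⟩).reachable
  have hs : s ∈ privateNeighbors G u w := by
    refine ⟨hus, fun hsw => h (hsw ▸ hus'), fun hws => h (hus'.trans ?_)⟩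
    exact (deleteEdges_adj.2 ⟨hws.symm, by rw [Set.mem_singleton_iff]; grind⟩).reachable
  have hcomm : (G.deleteIncidenceSet u).deleteEdges {s(w, x)} =
      (G.deleteEdges {s(w, x)}).deleteIncidenceSet u := by
    ext a b
    simp only [deleteIncidenceSet_adj, deleteEdges_adj]
    tauto
  rcases reachable_deleteEdges_or_of_reachable (x := w) hsx with hsx | hsw
  · exact ⟨s, hs, .inr ((hcomm ▸ hsx).mono deleteEdges_deleteIncidenceSet_le).symm⟩
  · exact absurd (hus'.trans ((hcomm ▸ hsw).mono (deleteIncidenceSet_le _ _))) h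

end Switch

open Classical in
/-- A connected graph whose degrees decrease along the vertex order, and in which no edge switch
raising the sum over the edges `ab` of the product of the positions of `a` and `b` keeps the
graph connected. -/
structure IsSwitchOptimal {V : Type*} [Fintype V] [LinearOrder V] (G : SimpleGraph V) : Prop where
  connected : G.Connected
  degree_antitone : Antitone fun v => G.degree v
  not_connected_edgeSwitch : ∀ ⦃u x v y⦄, u < x → v ∈ privateNeighbors G u x →
    y ∈ privateNeighbors G x u → y < v → ¬ (edgeSwitch G u v x y).Connected

namespace IsSwitchOptimal

section Order

variable {V : Type*} [Fintype V] [LinearOrder V] {G : SimpleGraph V} {u w x y : V}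

theorem ncard_privateNeighbors_le (hG : IsSwitchOptimal G) (huw : u < w) :
    (privateNeighbors G w u).ncard ≤ (privateNeighbors G u w).ncard := by
  classical
  exact _root_.ncard_privateNeighbors_le (by convert hG.degree_antitone huw.le)

theorem exists_mem_privateNeighbors_lt (hG : IsSwitchOptimal G) (huw : u < w)
    (hx : x ∈ privateNeighbors G w u) : ∃ v ∈ privateNeighbors G u w, v < x := by
  classical
  obtain ⟨v, hv, hreach⟩ := exists_reachable_of_degree_le hG.connected huw.ne
    (by convert hG.degree_antitone huw.le) hx
  have hne : v ≠ x := fun h => hx.2.2 (h ▸ hv.1)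
  refine ⟨v, hv, hne.lt_of_le (not_lt.1 fun hxv => ?_)⟩
  exact hG.not_connected_edgeSwitch huw hv hx hxv
    (connected_edgeSwitch hG.connected hv hx hreach)

variable [OrderBot V]

theorem monotone_dist_bot (hG : IsSwitchOptimal G) : Monotone (G.dist ⊥) := by
  suffices h : ∀ n, ∀ i j, G.dist ⊥ j = n → i < j → G.dist ⊥ i ≤ G.dist ⊥ j from
    fun i j hij => hij.eq_or_lt.elim (fun h => h ▸ le_rfl) (h _ i j rfl)
  intro n
  induction n using Nat.strong_induction_on with
  | _ n ih =>
    rintro i j rfl hij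
    obtain ⟨p, hjp, hp⟩ := exists_adj_dist_add_one_eq (hG.connected.preconnected ⊥ j)
      (bot_le.trans_lt hij).ne'
    by_cases hpi : p = i
    · subst hpi
      omega
    by_cases hip : G.Adj i p
    · have := dist_le_dist_add_one (r := ⊥) hip.symm
      omega
    obtain ⟨q, hq, hqp⟩ := hG.exists_mem_privateNeighbors_lt hij ⟨hjp, hpi, hip⟩
    have hqp_dist := ih _ (by omega) q p rfl hqp
    have := dist_le_dist_add_one (r := ⊥) hq.1.symm
    omega

theorem exists_adj_lt (hG : IsSwitchOptimal G) (hx : x ≠ ⊥) : ∃ y < x, G.Adj x y := by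
  obtain ⟨y, hxy, hy⟩ := exists_adj_dist_add_one_eq (hG.connected.preconnected ⊥ x) hx
  refine ⟨y, not_le.1 fun h => ?_, hxy⟩
  have := hG.monotone_dist_bot h
  omega

theorem lt_of_mem_privateNeighbors (hG : IsSwitchOptimal G) (huw : u < w) {p q w' : V}
    (hp : p ∈ privateNeighbors G w u) (hq : q ∈ privateNeighbors G u w) (hw : G.Adj w w')
    (hwp : w' < p) : q < p := by
  have hne : q ≠ p := fun h => hp.2.2 (h ▸ hq.1)
  refine hne.lt_of_le (not_lt.1 fun hpq => ?_)
  obtain ⟨u', hu', hup⟩ := hG.exists_mem_privateNeighbors_lt huw hp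
  set R := G.deleteEdges {s(u, q), s(w, p)}
  have hbot {a : V} (ha : a < p) : R.Reachable a ⊥ := by
    refine reachable_bot_of_forall_exists_adj_lt (fun y hy hy0 => ?_) ha
    obtain ⟨z, hzy, hyz⟩ := hG.exists_adj_lt hy0
    exact ⟨z, hzy, deleteEdges_adj.2 ⟨hyz, by
      simp only [Set.mem_insert_iff, Set.mem_singleton_iff]; grind⟩⟩
  have huu' : R.Adj u u' := deleteEdges_adj.2 ⟨hu'.1, by
    simp only [Set.mem_insert_iff, Set.mem_singleton_iff]; grind⟩
  have hww' : R.Adj w w' := deleteEdges_adj.2 ⟨hw, by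
    have := hq.2.1
    simp only [Set.mem_insert_iff, Set.mem_singleton_iff]; grind⟩
  refine hG.not_connected_edgeSwitch huw hq hp hpq
    (connected_edgeSwitch hG.connected hq hp (.inl ?_))
  exact huu'.reachable.trans <| (hbot hup).trans <| (hbot hwp).symm.trans hww'.symm.reachable

end Order

theorem isBFSOrdering {n : ℕ} [NeZero n] {G : SimpleGraph (Fin n)} (hG : IsSwitchOptimal G) :
    IsBFSOrdering G (Equiv.refl (Fin n)) where
  connected := hG.connected
  degree_anti _ _ hij := hG.degree_antitone hij
  dist_mono _ _ hij := hG.monotone_dist_bot hij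
  children u w v z huv hwv hwz huz huw hv hz hlt := by
    simp only [Equiv.refl_apply] at huv hwv hwz huz huw hv hz
    obtain ⟨w', hww', hw'⟩ :=
      exists_adj_dist_add_one_eq (hG.connected.preconnected 0 w) (Fin.zero_le u |>.trans_lt hlt).ne'
    have hwz' : w' < z := not_le.1 fun h => by
      have : G.dist 0 z ≤ G.dist 0 w' := hG.monotone_dist_bot h
      omega
    refine hG.lt_of_mem_privateNeighbors hlt ⟨hwz, ?_, huz⟩ ⟨huv, ?_, hwv⟩ hww' hwz'
    · rintro rfl
      omega
    · rintro rfl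
      omega

end IsSwitchOptimal

section LeastFork

variable {V : Type*} [LinearOrder V] {G : SimpleGraph V} {a' a b : V}

/-- Both `a' < a` are smaller neighbours of `b`, and no vertex below `a` is the larger of two
smaller neighbours of some vertex: `a` is the first vertex at which a cycle shows up in the
vertex order. -/
structure IsLeastFork (G : SimpleGraph V) (a' a b : V) : Prop where
  left_lt : a' < a
  lt_top : a < b
  adj_left : G.Adj b a'
  adj : G.Adj b a
  le_of_adj : ∀ ⦃x y z⦄, x < y → y < z → G.Adj z x → G.Adj z y → a ≤ y

theorem IsLeastFork.eq_of_adj (h : IsLeastFork G a' a b) {x y z : V} (hx : x ≤ a) (hy : y < x)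
    (hz : z < x) (hxy : G.Adj x y) (hxz : G.Adj x z) : y = z := by
  by_contra hne
  rcases lt_or_gt_of_ne hne with hyz | hzy
  · exact (hz.trans_le hx).not_ge (h.le_of_adj hyz hz hxy hxz)
  · exact (hy.trans_le hx).not_ge (h.le_of_adj hzy hy hxz hxy)

theorem exists_adj_sup {e : Sym2 V} (he : e ∈ G.edgeSet) :
    ∃ x < e.sup, e = s(x, e.sup) ∧ G.Adj e.sup x := by
  induction e with
  | _ x y =>
    have hxy : G.Adj x y := he
    rcases lt_or_gt_of_ne hxy.ne with h | h
    · exact ⟨x, by simpa using h, by simp [h.le], by simpa [h.le] using hxy.symm⟩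
    · exact ⟨y, by simpa using h, by simp [h.le, Sym2.eq_swap], by simpa [h.le] using hxy⟩

open Classical in
theorem exists_isLeastFork [Fintype V] [OrderBot V] (h : Fintype.card V ≤ G.edgeFinset.card) :
    ∃ a' a b, IsLeastFork G a' a b := by
  have hcard : (Finset.univ.erase (⊥ : V)).card < G.edgeFinset.card := by
    refine lt_of_lt_of_le (Finset.card_erase_lt_of_mem (Finset.mem_univ _)) ?_
    rwa [Finset.card_univ]
  have hsup : ∀ e ∈ G.edgeFinset, e.sup ∈ Finset.univ.erase (⊥ : V) := by
    intro e he
    obtain ⟨x, hx, -⟩ := exists_adj_sup (mem_edgeFinset.1 he)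
    simpa using (bot_le.trans_lt hx).ne'
  obtain ⟨e, he, e', he', hne, heq⟩ := Finset.exists_ne_map_eq_of_card_lt_of_maps_to hcard hsup
  obtain ⟨x, hx, hex, hadj⟩ := exists_adj_sup (mem_edgeFinset.1 he)
  obtain ⟨x', hx', hex', hadj'⟩ := exists_adj_sup (mem_edgeFinset.1 he')
  rw [← heq] at hx' hex' hadj'
  have hxx' : x ≠ x' := fun h => hne (hex.trans (h ▸ hex'.symm))
  have hforks : {a | ∃ a' b, a' < a ∧ a < b ∧ G.Adj b a' ∧ G.Adj b a}.Nonempty := by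
    rcases lt_or_gt_of_ne hxx' with h | h
    · exact ⟨x', x, _, h, hx', hadj, hadj'⟩
    · exact ⟨x, x', _, h, hx, hadj', hadj⟩
  obtain ⟨a, ⟨a', b, hfork⟩, hmin⟩ := wellFounded_lt.has_min _ hforks
  exact ⟨a', a, b, hfork.1, hfork.2.1, hfork.2.2.1, hfork.2.2.2,
    fun x y z hxy hyz hzx hzy => not_lt.1 (hmin y ⟨x, z, hxy, hyz, hzx, hzy⟩)⟩

end LeastFork

theorem four_add_ncard_Ioo_le_ncard_Iio {V : Type*} [LinearOrder V] [Finite V] {x i j k a : V}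
    (hxi : x < i) (hij : i < j) (hjk : j < k) (hka : k < a) :
    4 + (Set.Ioo k a).ncard ≤ (Set.Iio a).ncard := by
  have hfour : ({x, i, j, k} : Set V).ncard = 4 := by
    rw [Set.ncard_insert_of_notMem, Set.ncard_insert_of_notMem, Set.ncard_pair hjk.ne]
    all_goals simp only [Set.mem_insert_iff, Set.mem_singleton_iff]; grind
  have hdisj : Disjoint {x, i, j, k} (Set.Ioo k a) := by
    rw [Set.disjoint_left]
    simp only [Set.mem_insert_iff, Set.mem_singleton_iff, Set.mem_Ioo]
    grind
  rw [← hfour, ← Set.ncard_union_eq hdisj (Set.toFinite _) (Set.toFinite _)]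
  refine Set.ncard_le_ncard (fun y => ?_) (Set.toFinite _)
  simp only [Set.mem_union, Set.mem_insert_iff, Set.mem_singleton_iff, Set.mem_Ioo, Set.mem_Iio]
  grind

namespace IsSwitchOptimal

section Triangle

variable {V : Type*} [Fintype V] [LinearOrder V] [OrderBot V] {G : SimpleGraph V}
  {a' a b i j k : V}

theorem exists_adj_lt_of_isLeastFork (hG : IsSwitchOptimal G) (hF : IsLeastFork G a' a b) {u : V}
    (hua : u < a) (hadj : ¬ G.Adj u a) (hne : u ≠ a') : ∃ v, u < v ∧ v < a ∧ G.Adj u v := by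
  by_contra! hgap
  have hub := hua.trans hF.lt_top
  have ha : a ∈ privateNeighbors G b u := ⟨hF.adj, hua.ne', hadj⟩
  have hlt : ∀ q ∈ privateNeighbors G u b, q < u := fun q hq =>
    hq.1.ne'.lt_of_le <| not_lt.1 fun huq => hgap q huq
      (hG.lt_of_mem_privateNeighbors hub ha hq hF.adj_left hF.left_lt) hq.1
  have hsub : (privateNeighbors G u b).Subsingleton := fun q hq r hr =>
    hF.eq_of_adj hua.le (hlt q hq) (hlt r hr) hq.1 hr.1
  have hsub' : (privateNeighbors G b u).Subsingleton := by
    rw [← Set.ncard_le_one_iff_subsingleton] at hsub ⊢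
    exact (hG.ncard_privateNeighbors_le hub).trans hsub
  have hua' : G.Adj u a' := by
    by_contra hua'
    exact hF.left_lt.ne (hsub' ⟨hF.adj_left, hne.symm, hua'⟩ ha)
  have ha'u : a' < u := hne.symm.lt_of_le <| not_lt.1 fun h => hgap a' h hF.left_lt hua'
  obtain ⟨q, hq, -⟩ := hG.exists_mem_privateNeighbors_lt hub ha
  exact hq.2.2 (hF.eq_of_adj hua.le (hlt q hq) ha'u hq.1 hua' ▸ hF.adj_left)

theorem adj_bot_of_le (hG : IsSwitchOptimal G) (hi : i ≠ ⊥) (hij : i ≤ j) (hj : G.Adj ⊥ j) :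
    G.Adj ⊥ i := by
  have hdist := hG.monotone_dist_bot hij
  have := hG.connected.pos_dist_of_ne hi.symm
  rw [← dist_eq_one_iff_adj] at hj ⊢
  omega

open Classical in
theorem adj_bot_of_ncard_Iio_le (hG : IsSwitchOptimal G) (hi : i ≠ ⊥)
    (hdeg : (Set.Iio i).ncard ≤ G.degree ⊥) : G.Adj ⊥ i := by
  by_contra hadj
  have hsub : G.neighborSet ⊥ ⊆ Set.Iio i \ {⊥} := fun j hj =>
    ⟨not_le.1 fun hij => hadj (hG.adj_bot_of_le hi hij hj), hj.ne'⟩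
  have hlt : (Set.Iio i \ {⊥}).ncard < (Set.Iio i).ncard :=
    Set.ncard_sdiff_singleton_lt_of_mem (bot_lt_iff_ne_bot.2 hi)
  have hle := Set.ncard_le_ncard hsub
  rw [← Nat.card_coe_set_eq, Nat.card_eq_fintype_card, card_neighborSet_eq_degree] at hle
  omega

theorem adj_of_isLeastFork_of_bot_covBy (hG : IsSwitchOptimal G) (hF : IsLeastFork G a' i b)
    (hi : ⊥ ⋖ i) (hij : i ⋖ j) : G.Adj i j := by
  by_contra hadj
  have hbj : j < b := (hij.ge_of_gt hF.lt_top).lt_of_ne fun h => hadj (h ▸ hF.adj.symm)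
  obtain ⟨q, hq, hqi⟩ :=
    hG.exists_mem_privateNeighbors_lt hbj ⟨hF.adj, hij.lt.ne, fun h => hadj h.symm⟩
  have hq_bot : q = ⊥ := le_bot_iff.1 (hi.le_of_lt hqi)
  have ha'_bot : a' = ⊥ := le_bot_iff.1 (hi.le_of_lt hF.left_lt)
  exact hq.2.2 (hq_bot ▸ ha'_bot ▸ hF.adj_left)

theorem eq_of_isLeastFork_of_covBy (hG : IsSwitchOptimal G) (hF : IsLeastFork G a' j b)
    (hij : i ⋖ j) (hadj : ¬ G.Adj i j) : i = a' := by
  by_contra hne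
  obtain ⟨v, hiv, hvj, -⟩ := hG.exists_adj_lt_of_isLeastFork hF hij.lt hadj hne
  exact hij.2 hiv hvj

theorem adj_of_isLeastFork_of_covBy (hG : IsSwitchOptimal G) (hF : IsLeastFork G a' j b)
    (hi : ⊥ ⋖ i) (hij : i ⋖ j) (hjk : j ⋖ k) (hk : G.Adj ⊥ k) : G.Adj i j := by
  by_contra hadj
  obtain rfl := hG.eq_of_isLeastFork_of_covBy hF hij hadj
  have hki : ¬ G.Adj k i := fun h =>
    hij.lt.not_ge (hF.le_of_adj hi.lt (hij.lt.trans hjk.lt) hk.symm h)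
  have hkj : ¬ G.Adj k j := fun h => hi.lt.ne'
    (hG.eq_of_isLeastFork_of_covBy ⟨bot_le.trans_lt hij.lt, hjk.lt, hk.symm, h, hF.le_of_adj⟩
      hij hadj)
  have hkb : k < b := (hjk.ge_of_gt hF.lt_top).lt_of_ne fun h => hkj (h ▸ hF.adj)
  have hi_mem : i ∈ privateNeighbors G b k := ⟨hF.adj_left, (hij.lt.trans hjk.lt).ne, hki⟩
  have hj_mem : j ∈ privateNeighbors G b k := ⟨hF.adj, hjk.lt.ne, hkj⟩
  have hbot : ∀ q ∈ privateNeighbors G k b, q = ⊥ := fun q hq => by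
    have hqi : q ≤ i := hij.le_of_lt
      (hG.lt_of_mem_privateNeighbors hkb hj_mem hq hF.adj_left hij.lt)
    exact le_bot_iff.1 (hi.le_of_lt (hqi.lt_of_ne fun h => hki (h ▸ hq.1)))
  have hsub : (privateNeighbors G k b).Subsingleton := fun q hq r hr =>
    (hbot q hq).trans (hbot r hr).symm
  have hsub' : (privateNeighbors G b k).Subsingleton := by
    rw [← Set.ncard_le_one_iff_subsingleton] at hsub ⊢
    exact (hG.ncard_privateNeighbors_le hkb).trans hsub
  exact hij.lt.ne (hsub' hi_mem hj_mem)

theorem adj_of_isLeastFork_of_adj_bot (hG : IsSwitchOptimal G) (hF : IsLeastFork G a' k b)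
    (hi : ⊥ ⋖ i) (hij : i ⋖ j) (hjk : j ⋖ k) (hk : G.Adj ⊥ k) : G.Adj i j := by
  have hnot : ∀ u, ⊥ < u → u < k → ¬ G.Adj u k := fun u hu huk h =>
    hu.ne (hF.eq_of_adj le_rfl (bot_le.trans_lt huk) huk hk.symm h.symm)
  have hj : j = a' := hG.eq_of_isLeastFork_of_covBy hF hjk (hnot j (hi.lt.trans hij.lt) hjk.lt)
  obtain ⟨v, hiv, hvk, hadj⟩ := hG.exists_adj_lt_of_isLeastFork hF (hij.lt.trans hjk.lt)
    (hnot i hi.lt (hij.lt.trans hjk.lt)) (hj ▸ hij.lt.ne)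
  rwa [(hjk.le_of_lt hvk).antisymm (hij.ge_of_gt hiv)] at hadj

theorem le_of_isLeastFork (hG : IsSwitchOptimal G) (hF : IsLeastFork G a' a b)
    (hi : ⊥ ⋖ i) (hij : i ⋖ j) (hjk : j ⋖ k) (hk : G.Adj ⊥ k) : a ≤ k := by
  by_contra! hka
  have hparent : ∀ x, x ≠ ⊥ → ∃ y < x, G.Adj x y := fun x hx => hG.exists_adj_lt hx
  choose! par hpar_lt hpar using hparent
  have hpar_eq {x y : V} (hx : x ≤ a) (hy : y < x) (hxy : G.Adj x y) : par x = y :=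
    have hx0 : x ≠ ⊥ := (bot_le.trans_lt hy).ne'
    hF.eq_of_adj hx (hpar_lt x hx0) hy (hpar x hx0) hxy
  -- `u < a` with `u ≠ ⊥, a', par a` has a child `v < a`; vertices up to `k` have parent `⊥`.
  have hsub : Set.Iio a ⊆ {⊥, a', par a} ∪ par '' Set.Ioo k a := by
    intro u hua
    by_cases hu0 : u = ⊥
    · simp [hu0]
    by_cases hua' : u = a'
    · simp [hua']
    by_cases hadj : G.Adj u a
    · simp [hpar_eq le_rfl hua hadj.symm]
    obtain ⟨v, huv, hva, hadj⟩ := hG.exists_adj_lt_of_isLeastFork hF hua hadj hua'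
    have hpv : par v = u := hpar_eq hva.le huv hadj.symm
    refine .inr ⟨v, ⟨not_le.1 fun hvk => hu0 ?_, hva⟩, hpv⟩
    have hv0 : v ≠ ⊥ := (bot_le.trans_lt huv).ne'
    exact hpv ▸ hpar_eq hva.le (bot_lt_iff_ne_bot.2 hv0) (hG.adj_bot_of_le hv0 hvk hk).symm
  have hle : (Set.Iio a).ncard ≤ 3 + (Set.Ioo k a).ncard := calc
    _ ≤ ({⊥, a', par a} ∪ par '' Set.Ioo k a).ncard := Set.ncard_le_ncard hsub (Set.toFinite _)
    _ ≤ ({⊥, a', par a} : Set V).ncard + (par '' Set.Ioo k a).ncard := Set.ncard_union_le _ _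
    _ ≤ 3 + (Set.Ioo k a).ncard := by
      refine add_le_add ?_ (Set.ncard_image_le (Set.toFinite _))
      classical
      simpa [Set.ncard_eq_toFinset_card'] using Finset.card_le_three (a := ⊥) (b := a') (c := par a)
  have := four_add_ncard_Ioo_le_ncard_Iio hi.lt hij.lt hjk.lt hka
  omega

open Classical in
theorem adj_of_covBy (hG : IsSwitchOptimal G) (hcard : Fintype.card V ≤ G.edgeFinset.card)
    (hi : ⊥ ⋖ i) (hij : i ⋖ j) (hjk : j ⋖ k) (hk : G.Adj ⊥ k) : G.Adj i j := by
  obtain ⟨a', a, b, hF⟩ := exists_isLeastFork hcard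
  rcases (hG.le_of_isLeastFork hF hi hij hjk hk).eq_or_lt with rfl | hak
  · exact hG.adj_of_isLeastFork_of_adj_bot hF hi hij hjk hk
  rcases (hjk.le_of_lt hak).eq_or_lt with rfl | haj
  · exact hG.adj_of_isLeastFork_of_covBy hF hi hij hjk hk
  obtain rfl : a = i := (hij.le_of_lt haj).antisymm (hi.ge_of_gt (bot_le.trans_lt hF.left_lt))
  exact hG.adj_of_isLeastFork_of_bot_covBy hF hi hij

end Triangle

open Classical in
theorem firstThreeFormTriangle {n : ℕ} [NeZero n] {G : SimpleGraph (Fin n)}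
    (hG : IsSwitchOptimal G) (hcard : n ≤ G.edgeFinset.card) (h3 : 3 ≤ G.degree 0) :
    FirstThreeFormTriangle G := by
  have hn : 3 < n := by
    have := G.degree_lt_card_verts 0
    rw [Fintype.card_fin] at this
    omega
  have hi : (⊥ : Fin n) ⋖ ⟨1, by omega⟩ := Fin.covBy_iff.2 (Order.covBy_add_one _)
  have hij : (⟨1, by omega⟩ : Fin n) ⋖ ⟨2, by omega⟩ := Fin.covBy_iff.2 (Order.covBy_add_one _)
  have hjk : (⟨2, by omega⟩ : Fin n) ⋖ ⟨3, hn⟩ := Fin.covBy_iff.2 (Order.covBy_add_one _)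
  have hthree : (Set.Iio (⟨3, hn⟩ : Fin n)).ncard = 3 := by
    rw [Set.ncard_eq_toFinset_card', Set.toFinset_Iio, Fin.card_Iio]
  have hk : G.Adj ⊥ ⟨3, hn⟩ :=
    hG.adj_bot_of_ncard_Iio_le (bot_le.trans_lt hjk.lt).ne' (hthree.trans_le h3)
  exact ⟨by omega, hG.adj_bot_of_le hi.lt.ne' (hij.le.trans hjk.le) hk,
    hG.adj_bot_of_le (bot_le.trans_lt hij.lt).ne' hjk.le hk,
    hG.adj_of_covBy (by simpa using hcard) hi hij hjk hk⟩

end IsSwitchOptimal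

/-- The weak form of `IsEscalating`, without the strict inequality. A function `f` satisfies the
weak form of `IsDeEscalating` when `-f` satisfies this one. -/
structure IsWeaklyEscalating (f : ℝ → ℝ → ℝ) : Prop where
  symm : SymmetricOnPos f
  le : ∀ x₁ y₁ x₂ y₂ : ℝ, 0 < y₁ → y₁ ≤ x₁ → 0 < y₂ → y₂ ≤ x₂ →
    f x₂ y₁ + f x₁ y₂ ≤ f x₁ x₂ + f y₁ y₂

theorem IsEscalating.isWeaklyEscalating {f : ℝ → ℝ → ℝ} (hf : IsEscalating f) :
    IsWeaklyEscalating f :=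
  ⟨hf.symm, hf.le⟩

theorem IsDeEscalating.isWeaklyEscalating_neg {f : ℝ → ℝ → ℝ} (hf : IsDeEscalating f) :
    IsWeaklyEscalating (-f) where
  symm x y hx hy := congrArg Neg.neg (hf.symm x y hx hy)
  le x₁ y₁ x₂ y₂ h1 h2 h3 h4 := by
    have := hf.le x₁ y₁ x₂ y₂ h1 h2 h3 h4
    simp only [Pi.neg_apply]
    linarith

theorem connectivity_neg {V : Type*} [Fintype V] (f : ℝ → ℝ → ℝ) (G : SimpleGraph V) :
    connectivity (-f) G = -connectivity f G := by
  unfold connectivity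
  rw [← Finset.sum_neg_distrib]
  refine Finset.sum_congr rfl fun e _ => ?_
  induction e with
  | _ a b =>
    simp only [Sym2.lift_mk, Pi.neg_apply]
    ring

section Maximizer

variable {V : Type*} [Fintype V] {G : SimpleGraph V} {u v x y : V}

open Classical in
theorem connectivity_edgeSwitch {f : ℝ → ℝ → ℝ} (hf : SymmetricOnPos f) (hux : u ≠ x)
    (hv : v ∈ privateNeighbors G u x) (hy : y ∈ privateNeighbors G x u) :
    connectivity f (edgeSwitch G u v x y) +
        (f (G.degree u) (G.degree v) + f (G.degree x) (G.degree y)) =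
      connectivity f G + (f (G.degree u) (G.degree y) + f (G.degree x) (G.degree v)) := by
  have hpos {a b : V} (h : G.Adj a b) : (0 : ℝ) < G.degree a :=
    Nat.cast_pos.2 ((G.degree_pos_iff_exists_adj _).2 ⟨_, h⟩)
  have hsum := sum_edgeFinset_edgeSwitch
    (Sym2.lift ⟨fun u v => (f (G.degree u) (G.degree v) + f (G.degree v) (G.degree u)) / 2,
      fun _ _ => congrArg (· / 2) (add_comm _ _)⟩) hux hv hy
  simp only [Sym2.lift_mk, hf _ _ (hpos hv.1.symm) (hpos hv.1),
    hf _ _ (hpos hy.1.symm) (hpos hy.1), hf _ _ (hpos hy.1.symm) (hpos hv.1),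
    hf _ _ (hpos hv.1.symm) (hpos hy.1), add_self_div_two] at hsum
  simpa only [connectivity, degree_edgeSwitch hux hv hy] using hsum

open Classical in
theorem IsWeaklyEscalating.connectivity_le_connectivity_edgeSwitch {f : ℝ → ℝ → ℝ}
    (hf : IsWeaklyEscalating f) (hux : u ≠ x) (hv : v ∈ privateNeighbors G u x)
    (hy : y ∈ privateNeighbors G x u) (hxu : G.degree x ≤ G.degree u)
    (hvy : G.degree v ≤ G.degree y) :
    connectivity f G ≤ connectivity f (edgeSwitch G u v x y) := by
  have hx : 0 < G.degree x := (G.degree_pos_iff_exists_adj x).2 ⟨y, hy.1⟩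
  have hv' : 0 < G.degree v := (G.degree_pos_iff_exists_adj v).2 ⟨u, hv.1.symm⟩
  have hswitch := connectivity_edgeSwitch hf.symm hux hv hy
  have hle := hf.le (G.degree u) (G.degree x) (G.degree y) (G.degree v) (by exact_mod_cast hx)
    (by exact_mod_cast hxu) (by exact_mod_cast hv') (by exact_mod_cast hvy)
  have hxy := hf.symm (G.degree y) (G.degree x) (by exact_mod_cast hv'.trans_le hvy)
    (by exact_mod_cast hx)
  linarith

open Classical in
theorem sum_mul_lt_sum_mul_edgeSwitch {n : ℕ} {G : SimpleGraph (Fin n)} {u v x y : Fin n}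
    (hux : u < x) (hyv : y < v) (hv : v ∈ privateNeighbors G u x)
    (hy : y ∈ privateNeighbors G x u) :
    ∑ e ∈ G.edgeFinset, (e.map Fin.val).mul <
      ∑ e ∈ (edgeSwitch G u v x y).edgeFinset, (e.map Fin.val).mul := by
  have hswitch := sum_edgeFinset_edgeSwitch (fun e => (e.map Fin.val).mul) hux.ne hv hy
  simp only [Sym2.map_mk, Sym2.mul_mk] at hswitch
  have := mul_add_mul_lt_mul_add_mul (Fin.lt_def.1 hux) (Fin.lt_def.1 hyv)
  omega

end Maximizer

theorem exists_isMaxOn_connectivity_isSwitchOptimal {n : ℕ} {d : Fin n → ℕ} (hd : Antitone d)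
    (hne : (GraphsWithDegrees d).Nonempty) {f : ℝ → ℝ → ℝ} (hf : IsWeaklyEscalating f) :
    ∃ G ∈ GraphsWithDegrees d,
      IsMaxOn (connectivity f) (GraphsWithDegrees d) G ∧ IsSwitchOptimal G := by
  classical
  let maximizers := {G ∈ GraphsWithDegrees d | IsMaxOn (connectivity f) (GraphsWithDegrees d) G}
  have hmaximizers : maximizers.Nonempty :=
    Set.exists_max_image _ (connectivity f) (Set.toFinite _) hne
  -- Switches toward the vertex order can preserve `M_f`, so ties are broken by vertex positions.
  obtain ⟨G, ⟨hG, hmax⟩, htie⟩ := Set.exists_max_image maximizers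
    (fun G => ∑ e ∈ G.edgeFinset, (e.map Fin.val).mul) (Set.toFinite _) hmaximizers
  have hanti : Antitone fun i => G.degree i := fun i j hij => by
    simpa only [hG.2] using hd hij
  refine ⟨G, hG, hmax, hG.1, by convert hanti, fun u x v y hux hv hy hyv hconn => ?_⟩
  have hmem : edgeSwitch G u v x y ∈ GraphsWithDegrees d :=
    ⟨hconn, fun i => by rw [degree_edgeSwitch hux.ne hv hy, hG.2]⟩
  have hle := hf.connectivity_le_connectivity_edgeSwitch hux.ne hv hy (hanti hux.le)
    (hanti hyv.le)
  exact (htie _ ⟨hmem, fun H hH => (hmax hH).trans hle⟩).not_gt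
    (sum_mul_lt_sum_mul_edgeSwitch hux hyv hv hy)

namespace IsCyclicDegreeSequence

variable {n : ℕ} {c : ℕ} {d : Fin n → ℕ}

theorem sum_degrees_add_two (hd : IsCyclicDegreeSequence c d) : ∑ i, d i + 2 = 2 * (n + c) := by
  classical
  obtain ⟨-, G, hG, -, hcard⟩ := hd
  have hsum := G.sum_degrees_eq_twice_card_edges
  simp only [hG.2] at hsum
  rw [Fintype.card_fin] at hcard
  grind

theorem three_le_of_eq_one [NeZero n] (hd : IsCyclicDegreeSequence c d) (hc : 1 ≤ c) {i : Fin n}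
    (hi : d i = 1) : 3 ≤ d 0 := by
  by_contra! hlt
  have hsum := hd.sum_degrees_add_two
  have hlt : ∑ v, d v < ∑ _v : Fin n, 2 := by
    refine Finset.sum_lt_sum (fun v _ => ?_) ⟨i, Finset.mem_univ _, by omega⟩
    exact (hd.1 (Fin.zero_le v)).trans (by omega)
  simp only [Finset.sum_const, Finset.card_univ, Fintype.card_fin, smul_eq_mul] at hlt
  omega

open Classical in
theorem card_edgeFinset_add_one (hd : IsCyclicDegreeSequence c d) {G : SimpleGraph (Fin n)}
    (hG : G ∈ GraphsWithDegrees d) : G.edgeFinset.card + 1 = n + c := by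
  have hsum := G.sum_degrees_eq_twice_card_edges
  simp only [hG.2] at hsum
  have := hd.sum_degrees_add_two
  omega

theorem exists_isMaxOn_connectivity [NeZero n] (hd : IsCyclicDegreeSequence c d)
    (h3 : 1 ≤ c → 3 ≤ d 0) {f : ℝ → ℝ → ℝ} (hf : IsWeaklyEscalating f) :
    ∃ G ∈ GraphsWithDegrees d,
      IsMaxOn (connectivity f) (GraphsWithDegrees d) G ∧
      IsBFSOrdering G (Equiv.refl (Fin n)) ∧
      (1 ≤ c → FirstThreeFormTriangle G) := by
  obtain ⟨G, hG, hmax, hopt⟩ := exists_isMaxOn_connectivity_isSwitchOptimal hd.1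
    (hd.2.imp fun _ h => h.1) hf
  refine ⟨G, hG, hmax, hopt.isBFSOrdering, fun hc => hopt.firstThreeFormTriangle ?_ ?_⟩
  · have := hd.card_edgeFinset_add_one hG
    omega
  · rw [hG.2]
    exact h3 hc

end IsCyclicDegreeSequence

theorem mainTheorem1_general {n : ℕ} [NeZero n] (c : ℕ) (d : Fin n → ℕ)
    (hd : IsCyclicDegreeSequence c d) (h3 : 1 ≤ c → 3 ≤ d 0) (f : ℝ → ℝ → ℝ) :
    (IsWeaklyEscalating f →
      ∃ G ∈ GraphsWithDegrees d,
        IsMaxOn (connectivity f) (GraphsWithDegrees d) G ∧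
        IsBFSOrdering G (Equiv.refl (Fin n)) ∧
        (1 ≤ c → FirstThreeFormTriangle G)) ∧
    (IsWeaklyEscalating (-f) →
      ∃ G ∈ GraphsWithDegrees d,
        IsMinOn (connectivity f) (GraphsWithDegrees d) G ∧
        IsBFSOrdering G (Equiv.refl (Fin n)) ∧
        (1 ≤ c → FirstThreeFormTriangle G)) := by
  refine ⟨hd.exists_isMaxOn_connectivity h3, fun hf => ?_⟩
  obtain ⟨G, hG, hmax, hBFS⟩ := hd.exists_isMaxOn_connectivity h3 hf
  rw [funext (connectivity_neg f)] at hmax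
  exact ⟨G, hG, by simpa using hmax.neg, hBFS⟩

theorem mainTheorem1 {n : ℕ} [NeZero n] (c : ℕ) (d : Fin n → ℕ)
    (hd : IsCyclicDegreeSequence c d)
    (hlast : d ⟨n - 1, Nat.sub_lt (NeZero.pos n) one_pos⟩ = 1)
    (f : ℝ → ℝ → ℝ) :
    (IsEscalating f →
      ∃ G ∈ GraphsWithDegrees d,
        IsMaxOn (connectivity f) (GraphsWithDegrees d) G ∧
        IsBFSOrdering G (Equiv.refl (Fin n)) ∧
        (1 ≤ c → FirstThreeFormTriangle G)) ∧
    (IsDeEscalating f →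
      ∃ G ∈ GraphsWithDegrees d,
        IsMinOn (connectivity f) (GraphsWithDegrees d) G ∧
        IsBFSOrdering G (Equiv.refl (Fin n)) ∧
        (1 ≤ c → FirstThreeFormTriangle G)) := by
  have hgen := mainTheorem1_general c d hd (fun hc => hd.three_le_of_eq_one hc hlast) f
  exact ⟨fun hf => hgen.1 hf.isWeaklyEscalating, fun hf => hgen.2 hf.isWeaklyEscalating_neg⟩
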